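/- Let $3\le\alpha<\omega$. For a set $U$, consider on subsets $X,Y$ of $U^\alpha$ the operations $X+Y=X\cup Y$, $-X=U^\alpha\setminus X$, and, for $i,j<\alpha$, the cylindrification $C_iX=\{u\in U^\alpha : \exists u'\in X\ \forall l\neq i\ (u_l=u'_l)\}$, the diagonal constant $D_{ij}=\{u\in U^\alpha: u_i=u_j\}$, and the transposition $P_{ij}X=\{u\in U^\alpha: \exists u'\in X\ (u_i=u'_j,\ u_j=u'_i,\ u_l=u'_l \text{ for all } l\ne i,j)\}$. Let $Pse_\alpha$ be the class of all algebras $\langle A,+,-,C_i,D_{ij},P_{ij}\rangle_{i,j<\alpha}$, where, for some set $U$, $A$ is a family of subsets of $U^\alpha$ that is closed under these operations and contains all $D_{ij}$; let $Cs_\alpha$ be the class of algebras $\langle A,+,-,C_i,D_{ij}\rangle_{i,j<\alpha}$ defined in the same way without the operations $P_{ij}$. The corresponding operation symbols are $+,-,c_i,d_{ij},p_{ij}$. An equational axiom set for $Pse_\alpha$ is a set of equations true in $Pse_\alpha$ from which all equations true in $Pse_\alpha$ are derivable (in equational logic). Then every equational axiom set $E$ for $Pse_\alpha$ contains equations $e_n$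 $(n<\omega)$ such that, for each $n$, more than $n$ distinct algebraic variables occur in $e_n$ together with some transposition $p_{ij}$, some diagonal constant $d_{kl}$ and some cylindrification $c_m$ (where $i,j,k,l,m<\alpha$). Moreover, $Pse_\alpha$ is not finitely axiomatizable over $Cs_\alpha$: there is no finite set $F$ of equations such that the equations true in $Pse_\alpha$ are exactly those derivable from $F$ together with all equations true in $Cs_\alpha$. -/

import Mathlib

open scoped FirstOrder

universe u v w

namespace EqLogic

/-- An equation `lhs = rhs` between terms of the language `L`, whose algebraic variables are
indexed by `ℕ`. -/
structure Equation (L : FirstOrder.Language.{u, v}) where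
  /-- the left-hand side -/
  lhs : L.Term ℕ
  /-- the right-hand side -/
  rhs : L.Term ℕ

/-- The equation `e` is true in the algebra `M`: both sides agree under every evaluation. -/
def Holds {L : FirstOrder.Language.{u, v}} (M : Type w) [L.Structure M] (e : Equation L) : Prop :=
  ∀ x : ℕ → M, e.lhs.realize x = e.rhs.realize x

/-- Derivability from a set `E` of equations by the rules of equational logic. -/
inductive Derives {L : FirstOrder.Language.{u, v}} (E : Set (Equation L)) : L.Term ℕ → L.Term ℕ → Prop
  | ax (e : Equation L) : e ∈ E → Derives E e.lhs e.rhs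
  | refl (t : L.Term ℕ) : Derives E t t
  | symm {s t : L.Term ℕ} : Derives E s t → Derives E t s
  | trans {r s t : L.Term ℕ} : Derives E r s → Derives E s t → Derives E r t
  | cong {n : ℕ} (f : L.Functions n) (s t : Fin n → L.Term ℕ) :
      (∀ k, Derives E (s k) (t k)) → Derives E (FirstOrder.Language.Term.func f s) (FirstOrder.Language.Term.func f t)
  | subst {s t : L.Term ℕ} (σ : ℕ → L.Term ℕ) :
      Derives E s t → Derives E (s.subst σ) (t.subst σ)

/-- The equation `e` is derivable from the set `E` of equations. -/
def Derivable {L : FirstOrder.Language.{u, v}} (E : Set (Equation L)) (e : Equation L) : Prop :=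
  Derives E e.lhs e.rhs

/-- The operation symbol `f` occurs in a term. -/
def TermUses {L : FirstOrder.Language.{u, v}} {n : ℕ} (f : L.Functions n) : L.Term ℕ → Prop
  | FirstOrder.Language.Term.var _ => False
  | @FirstOrder.Language.Term.func _ _ m g ts =>
      (⟨m, g⟩ : Σ k, L.Functions k) = ⟨n, f⟩ ∨ ∃ k, TermUses f (ts k)

/-- The operation symbol `f` occurs in the equation `e`. -/
def Equation.Uses {L : FirstOrder.Language.{u, v}} {n : ℕ} (e : Equation L) (f : L.Functions n) : Prop :=
  TermUses f e.lhs ∨ TermUses f e.rhs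

/-- The finite set of algebraic variables that occur in the equation `e`. -/
def Equation.vars {L : FirstOrder.Language.{u, v}} (e : Equation L) : Finset ℕ :=
  e.lhs.varFinset ∪ e.rhs.varFinset

/-- Translation of an equation along an interpretation of operation symbols. -/
def Equation.map {L : FirstOrder.Language.{u, v}} {L' : FirstOrder.Language.{u, v}} (φ : L →ᴸ L') (e : Equation L) :
    Equation L' :=
  ⟨φ.onTerm e.lhs, φ.onTerm e.rhs⟩

end EqLogic

namespace SetAlgebra

open EqLogic

/-- The operation symbols `+, -, c_i, d_ij` of cylindric-type algebras of dimension `α`. -/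
inductive CylOp (α : ℕ) : ℕ → Type
  | add : CylOp α 2
  | neg : CylOp α 1
  | c (i : Fin α) : CylOp α 1
  | d (i j : Fin α) : CylOp α 0

/-- The operation symbols `+, -, c_i, d_ij, p_ij` of polyadic-type algebras of dimension `α`. -/
inductive PolOp (α : ℕ) : ℕ → Type
  | add : PolOp α 2
  | neg : PolOp α 1
  | c (i : Fin α) : PolOp α 1
  | d (i j : Fin α) : PolOp α 0
  | p (i j : Fin α) : PolOp α 1

/-- The algebraic language of `Cs_α`. -/
def cylLang (α : ℕ) : FirstOrder.Language.{0, 0} := ⟨CylOp α, fun _ => Empty⟩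

/-- The algebraic language of `Pse_α`. -/
def polLang (α : ℕ) : FirstOrder.Language.{0, 0} := ⟨PolOp α, fun _ => Empty⟩

/-- Each operation symbol of `Cs_α` is an operation symbol of `Pse_α`. -/
def cylToPol (α : ℕ) : cylLang α →ᴸ polLang α where
  onFunction := fun {_} f => match f with
    | .add => PolOp.add
    | .neg => PolOp.neg
    | .c i => PolOp.c i
    | .d i j => PolOp.d i j
  onRelation := fun {_} r => Empty.elim r

/-- The cylindrification `C_i^U`. -/
def cylindrification {α : ℕ} {U : Type u} (i : Fin α) (X : Set (Fin α → U)) :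
    Set (Fin α → U) :=
  {a | ∃ b ∈ X, ∀ j, j ≠ i → a j = b j}

/-- The diagonal constant `D_ij^U`. -/
def diagonal {α : ℕ} (U : Type u) (i j : Fin α) : Set (Fin α → U) :=
  {a | a i = a j}

/-- The polyadic transposition operation `P_ij`. -/
def transposition {α : ℕ} {U : Type u} (i j : Fin α) (X : Set (Fin α → U)) :
    Set (Fin α → U) :=
  {a | ∃ b ∈ X, a i = b j ∧ a j = b i ∧ ∀ l, l ≠ i → l ≠ j → a l = b l}

/-- The algebra of all subsets of `U^α` with the cylindric operations. -/
instance fullCs (α : ℕ) (U : Type u) : (cylLang α).Structure (Set (Fin α → U)) where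
  funMap := fun {_} f => match f with
    | .add => fun X => X 0 ∪ X 1
    | .neg => fun X => (X 0)ᶜ
    | .c i => fun X => cylindrification i (X 0)
    | .d i j => fun _ => diagonal U i j
  RelMap := fun {_} r => Empty.elim r

/-- The algebra of all subsets of `U^α` with the polyadic equality operations. -/
instance fullPse (α : ℕ) (U : Type u) : (polLang α).Structure (Set (Fin α → U)) where
  funMap := fun {_} f => match f with
    | .add => fun X => X 0 ∪ X 1
    | .neg => fun X => (X 0)ᶜ
    | .c i => fun X => cylindrification i (X 0)
    | .d i j => fun _ => diagonal U i j
    | .p i j => fun X => transposition i j (X 0)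
  RelMap := fun {_} r => Empty.elim r

/-- A cylindric set algebra of dimension `α` with base set `U`: a family of subsets of `U^α`
that is closed under the operations and contains the constants. -/
abbrev Cs (α : ℕ) (U : Type u) := (cylLang α).Substructure (Set (Fin α → U))

/-- A polyadic equality set algebra of dimension `α` with base set `U`: a family of subsets of
`U^α` that is closed under the operations and contains the constants. -/
abbrev Pse (α : ℕ) (U : Type u) := (polLang α).Substructure (Set (Fin α → U))

/-- The set of equations true in (all members of) `Cs_α`. -/
def csTheory (α : ℕ) : Set (Equation (cylLang α)) :=
  {e | ∀ (U : Type u) (A : Cs α U), Holds A e}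

/-- The set of equations true in (all members of) `Pse_α`. -/
def pseTheory (α : ℕ) : Set (Equation (polLang α)) :=
  {e | ∀ (U : Type u) (A : Pse α U), Holds A e}

/-- `E` is an equational axiom set for `Pse_α`: its members are true in `Pse_α`, and all equations
true in `Pse_α` are derivable from it. -/
def IsEquationalAxiomSet (α : ℕ) (E : Set (Equation (polLang α))) : Prop :=
  E ⊆ pseTheory.{u} α ∧ ∀ e ∈ pseTheory.{u} α, Derivable E e

/-- `Pse_α` is finitely axiomatizable over `Cs_α`: for some finite set `F` of equations, the
equations true in `Pse_α` are exactly those derivable from `F` together with all equations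
true in `Cs_α`. -/
def FinitelyAxiomatizableOverCs (α : ℕ) : Prop :=
  ∃ F : Set (Equation (polLang α)), F.Finite ∧
    ∀ e, e ∈ pseTheory.{u} α ↔
      Derivable (F ∪ Equation.map (cylToPol α) '' csTheory.{u} α) e

end SetAlgebra

/-! ### Equational logic: soundness relative to a subuniverse. -/

namespace EqLogic

open FirstOrder.Language

/-! The proof builds an algebra that violates one equation of `Pse`, yet satisfies every equation of
`Pse` that has few variables or lacks one of the three kinds of symbols. If all members of an axiom
set were of these harmless sorts, the violated equation could not be derived from them.

The violated equation, `colouringEquation`, rests on parity. Suppose `k` disjoint symmetric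
irreflexive relations, `k` even, all meet every vertex of a graph with at most `k + 1` vertices.
Then there are exactly `k + 1` vertices, and each relation is a perfect matching of an odd set,
which is impossible (`not_exists_one_factorization`). The bound on the number of vertices is also
expressed by variables.

The algebra consists of the `Saturated` sets of pairs (sequence, colour). Its base has `k + 1`
points, and there are `k` colours. Only on regular sequences (two distinct points and one label of
each sort, in some order) does the colour matter, so each orbit of regular sequences splits into `k`
pieces. Since cylindrifications forget the colour, every pair of distinct points formally carries
every colour, and the equation fails (`colouringEquation_fails`).

To verify a harmless equation, sequences receive genuine colours `χ`, and a saturated set is sent to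
the set of sequences whose coloured image lies in it (`represent`). Cylindrifications need every
colour to be reachable by changing any one coordinate, transpositions need `χ` to be symmetric, and
diagonals need the projection of the base to be injective. Parity forbids having all of this at
once, but any one requirement can be dropped (`realize_eq_of_not_uses_c`,
`realize_eq_of_not_uses_p`, `realize_eq_of_not_uses_d`). With few variables many colours are
indistinguishable, and all requirements can be met after identifying them
(`realize_eq_of_card_vars_le`). -/

/-- A predicate closed under the operations is inherited by term values, and a map that respects
the operations occurring in a term commutes with the evaluation of that term. -/
theorem realize_of_preserves {L : FirstOrder.Language.{u, v}} {A B : Type*} [L.Structure A]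
    [L.Structure B] (S : A → Prop)
    (hS : ∀ (n : ℕ) (f : L.Functions n) (x : Fin n → A), (∀ i, S (x i)) → S (Structure.funMap f x))
    (φ : A → B) (x : ℕ → A) (t : L.Term ℕ)
    (hφ : ∀ (n : ℕ) (f : L.Functions n), TermUses f t → ∀ x : Fin n → A, (∀ i, S (x i)) →
      φ (Structure.funMap f x) = Structure.funMap f (φ ∘ x))
    (hx : ∀ v ∈ t.varFinset, S (x v)) :
    S (t.realize x) ∧ φ (t.realize x) = t.realize (φ ∘ x) := by
  induction t with
  | var v => exact ⟨hx v (by simp [Term.varFinset]), rfl⟩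
  | func f ts ih =>
    have key := fun i => ih i (fun n g hg => hφ n g (Or.inr ⟨i, hg⟩))
      (fun v hv => hx v (by
        simp only [Term.varFinset, Finset.mem_biUnion, Finset.mem_univ, true_and]
        exact ⟨i, hv⟩))
    refine ⟨hS _ f _ fun i => (key i).1, ?_⟩
    simp only [Term.realize]
    rw [hφ _ f (Or.inl rfl) _ fun i => (key i).1]
    congr 1
    funext i
    exact (key i).2

/-- Soundness of equational logic relative to a subuniverse. -/
theorem Derives.sound {L : FirstOrder.Language.{u, v}} {A : Type*} [L.Structure A] (S : A → Prop)
    (hS : ∀ (n : ℕ) (f : L.Functions n) (x : Fin n → A), (∀ i, S (x i)) → S (Structure.funMap f x))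
    {E : Set (Equation L)}
    (hE : ∀ e ∈ E, ∀ x : ℕ → A, (∀ n, S (x n)) → e.lhs.realize x = e.rhs.realize x)
    {s t : L.Term ℕ} (h : Derives E s t) (x : ℕ → A) (hx : ∀ n, S (x n)) :
    s.realize x = t.realize x := by
  induction h generalizing x with
  | ax e he => exact hE e he x hx
  | refl => rfl
  | symm _ ih => exact (ih x hx).symm
  | trans _ _ ih₁ ih₂ => exact (ih₁ x hx).trans (ih₂ x hx)
  | cong f s t _ ih =>
    simp only [Term.realize]
    congr 1
    funext i
    exact ih i x hx
  | subst σ _ ih =>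
    rw [Term.realize_subst, Term.realize_subst]
    exact ih _ fun n => (realize_of_preserves S hS id x (σ n) (fun _ _ _ _ _ => rfl)
      fun v _ => hx v).1

end EqLogic

/-! ### Coloured set algebras and the transfer of equations. -/

namespace SetAlgebra

open EqLogic FirstOrder.Language

theorem coe_realize {α : ℕ} {U : Type u} (A : Pse α U) (t : (polLang α).Term ℕ) (x : ℕ → A) :
    ((t.realize x : A) : Set (Fin α → U)) = t.realize fun n => (x n : Set (Fin α → U)) :=
  (HomClass.realize_term A.subtype (t := t) (v := x)).symm

theorem mem_pseTheory {α : ℕ} {e : Equation (polLang α)} :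
    e ∈ pseTheory.{u} α ↔ ∀ U : Type u, Holds (Set (Fin α → U)) e := by
  constructor
  · intro h U x
    have := congrArg Subtype.val (h U ⊤ fun n => ⟨x n, trivial⟩)
    rwa [coe_realize, coe_realize] at this
  · intro h U A x
    apply Subtype.ext
    rw [coe_realize, coe_realize]
    exact h U _

theorem mem_transposition {α : ℕ} {U : Type u} {i j : Fin α} {X : Set (Fin α → U)}
    {a : Fin α → U} : a ∈ transposition i j X ↔ a ∘ Equiv.swap i j ∈ X := by
  constructor
  · rintro ⟨b, hb, h1, h2, h3⟩
    convert hb using 1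
    funext l
    simp only [Function.comp, Equiv.swap_apply_def]
    split_ifs with hi hj
    · rw [h2, hi]
    · rw [h1, hj]
    · exact h3 l hi hj
  · intro h
    refine ⟨_, h, by simp, by simp, fun l hi hj => ?_⟩
    simp [Equiv.swap_apply_of_ne_of_ne hi hj]

/-- The algebra of all subsets of `M^α × J`: a colour from `J` is attached to every sequence, the
cylindrifications forget it and the transpositions preserve it. -/
instance colouredAlgebra (α : ℕ) (M : Type u) (J : Type v) :
    (polLang α).Structure (Set ((Fin α → M) × J)) where
  funMap := fun {_} f => match f with
    | .add => fun X => X 0 ∪ X 1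
    | .neg => fun X => (X 0)ᶜ
    | .c i => fun X => {p | ∃ q ∈ X 0, ∀ j, j ≠ i → p.1 j = q.1 j}
    | .d i j => fun _ => {p | p.1 i = p.1 j}
    | .p i j => fun X => {p | (p.1 ∘ Equiv.swap i j, p.2) ∈ X 0}
  RelMap := fun {_} r => Empty.elim r

/-- A map preserves the operation `f` on the arguments that satisfy `S`. -/
def Preserves {α : ℕ} {A B : Type*} [(polLang α).Structure A] [(polLang α).Structure B]
    (S : A → Prop) (φ : A → B) {n : ℕ} (f : (polLang α).Functions n) : Prop :=
  ∀ x : Fin n → A, (∀ i, S (x i)) → φ (Structure.funMap f x) = Structure.funMap f (φ ∘ x)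

/-- An equation true in a set algebra is true for those values that satisfy `S`, if a map to
the set algebra is injective on `S` and respects the operations that occur in the equation. -/
theorem realize_eq_of_preserves {α : ℕ} {A : Type*} [(polLang α).Structure A] {U : Type u}
    (S : A → Prop)
    (hS : ∀ (n : ℕ) (f : (polLang α).Functions n) (x : Fin n → A), (∀ i, S (x i)) →
      S (Structure.funMap f x))
    (φ : A → Set (Fin α → U)) (hinj : ∀ X Y, S X → S Y → φ X = φ Y → X = Y)
    {e : Equation (polLang α)} (he : e ∈ pseTheory.{u} α)
    (hφ : ∀ (n : ℕ) (f : (polLang α).Functions n), e.Uses f → Preserves S φ f)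
    (x : ℕ → A) (hx : ∀ v ∈ e.vars, S (x v)) : e.lhs.realize x = e.rhs.realize x := by
  have hl := realize_of_preserves S hS φ x e.lhs (fun n f hf => hφ n f (Or.inl hf))
    fun v hv => hx v (Finset.mem_union_left _ hv)
  have hr := realize_of_preserves S hS φ x e.rhs (fun n f hf => hφ n f (Or.inr hf))
    fun v hv => hx v (Finset.mem_union_right _ hv)
  refine hinj _ _ hl.1 hr.1 ?_
  rw [hl.2, hr.2]
  exact mem_pseTheory.1 he U _

end SetAlgebra

/-! ### The base set, its automorphisms and the saturated sets. -/

namespace SetAlgebra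

open EqLogic FirstOrder.Language

/-- The base set: a copy of `ZMod m`, its permutations, and `d + 1` infinite sorts of labels. -/
inductive Base (m d : ℕ) : Type u
  | pt (a : ZMod m) : Base m d
  | perm (z : Equiv.Perm (ZMod m)) : Base m d
  | lab (l : Fin (d + 1)) (x : ℤ) : Base m d

variable {m d : ℕ}

/-- The map of the base set induced by permutations of the points and of the labels. -/
def Base.act (π : Equiv.Perm (ZMod m)) (ρ : Fin (d + 1) → Equiv.Perm ℤ) :
    Base.{u} m d → Base.{u} m d
  | .pt a => .pt (π a)
  -- This choice makes the value `z a` of a permutation at a point invariant, which keeps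
  -- `pointClass` saturated.
  | .perm z => .perm (z * π⁻¹)
  | .lab l x => .lab l (ρ l x)

theorem Base.act_inv_act (π : Equiv.Perm (ZMod m)) (ρ : Fin (d + 1) → Equiv.Perm ℤ)
    (y : Base.{u} m d) : Base.act π⁻¹ (fun l => (ρ l)⁻¹) (Base.act π ρ y) = y := by
  cases y <;> simp [Base.act]

theorem Base.act_injective (π : Equiv.Perm (ZMod m)) (ρ : Fin (d + 1) → Equiv.Perm ℤ) :
    Function.Injective (Base.act.{u} (d := d) π ρ) :=
  Function.LeftInverse.injective (Base.act_inv_act π ρ)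

/-- The sequence with the points `a`, `b` in front, followed by the labels `x`. -/
def canon (a b : ZMod m) (x : Fin (d + 1) → ℤ) : Fin (d + 3) → Base.{u} m d :=
  Fin.cons (.pt a) (Fin.cons (.pt b) fun l => .lab l (x l))

@[simp] theorem canon_zero (a b : ZMod m) (x : Fin (d + 1) → ℤ) :
    canon.{u} a b x 0 = .pt a := rfl

@[simp] theorem canon_one (a b : ZMod m) (x : Fin (d + 1) → ℤ) :
    canon.{u} a b x 1 = .pt b := rfl

@[simp] theorem canon_succ_zero (a b : ZMod m) (x : Fin (d + 1) → ℤ) :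
    canon.{u} a b x (Fin.succ 0) = .pt b := rfl

@[simp] theorem canon_succ_succ (a b : ZMod m) (x : Fin (d + 1) → ℤ) (l : Fin (d + 1)) :
    canon.{u} a b x l.succ.succ = .lab l (x l) := rfl

theorem act_comp_canon (π : Equiv.Perm (ZMod m)) (ρ : Fin (d + 1) → Equiv.Perm ℤ) (a b : ZMod m)
    (x : Fin (d + 1) → ℤ) :
    Base.act.{u} π ρ ∘ canon a b x = canon (π a) (π b) fun l => ρ l (x l) := by
  funext i
  refine Fin.cases rfl (fun i => Fin.cases rfl (fun l => rfl) i) i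

/-- The sequences that are, up to the permutation `σ` of coordinates, two distinct points followed
by labels. -/
def Regular (σ : Equiv.Perm (Fin (d + 3))) (u : Fin (d + 3) → Base.{u} m d) : Prop :=
  ∃ a b x, a ≠ b ∧ u = canon a b x ∘ σ

theorem regular_act_iff {σ : Equiv.Perm (Fin (d + 3))} {u : Fin (d + 3) → Base.{u} m d}
    (π : Equiv.Perm (ZMod m)) (ρ : Fin (d + 1) → Equiv.Perm ℤ) :
    Regular σ (Base.act π ρ ∘ u) ↔ Regular σ u := by
  have key : ∀ (π : Equiv.Perm (ZMod m)) (ρ : Fin (d + 1) → Equiv.Perm ℤ)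
      (u : Fin (d + 3) → Base.{u} m d), Regular σ u → Regular σ (Base.act π ρ ∘ u) := by
    rintro π ρ _ ⟨a, b, x, hab, rfl⟩
    exact ⟨π a, π b, _, π.injective.ne hab, by rw [← Function.comp_assoc, act_comp_canon]⟩
  refine ⟨fun h => ?_, key π ρ u⟩
  have := key π⁻¹ (fun l => (ρ l)⁻¹) _ h
  rwa [show Base.act π⁻¹ (fun l => (ρ l)⁻¹) ∘ Base.act π ρ ∘ u = u from
    funext fun i => Base.act_inv_act π ρ (u i)] at this

/-- Two sequences in the same orbit of the automorphism group of the base set. -/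
def SameOrbit (u u' : Fin (d + 3) → Base.{u} m d) : Prop :=
  ∃ π ρ, u' = Base.act π ρ ∘ u

theorem SameOrbit.refl (u : Fin (d + 3) → Base.{u} m d) : SameOrbit u u :=
  ⟨1, fun _ => 1, by funext i; simp only [Function.comp]; cases u i <;> simp [Base.act]⟩

theorem exists_perm_pair {β : Type*} [DecidableEq β] {a b a' b' : β} (h : a ≠ b) (h' : a' ≠ b') :
    ∃ π : Equiv.Perm β, π a = a' ∧ π b = b' := by
  refine ⟨Equiv.swap (Equiv.swap a a' b) b' * Equiv.swap a a', ?_, by simp⟩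
  simp only [Equiv.Perm.mul_apply, Equiv.swap_apply_left]
  refine Equiv.swap_apply_of_ne_of_ne (fun h1 => h ?_) h'
  apply (Equiv.swap a a').injective
  rw [← h1, Equiv.swap_apply_left]

/-- Permutations act 2-transitively on points and independently transitively on each sort of labels.
Hence, for each `σ`, membership of a regular sequence in a saturated set depends on the colour
alone. -/
theorem Regular.sameOrbit {σ : Equiv.Perm (Fin (d + 3))} {u u' : Fin (d + 3) → Base.{u} m d}
    (h : Regular σ u) (h' : Regular σ u') : SameOrbit u u' := by
  obtain ⟨a, b, x, hab, rfl⟩ := h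
  obtain ⟨a', b', x', hab', rfl⟩ := h'
  obtain ⟨π, rfl, rfl⟩ := exists_perm_pair hab hab'
  refine ⟨π, fun l => Equiv.swap (x l) (x' l), ?_⟩
  rw [← Function.comp_assoc, act_comp_canon]
  simp

variable {J : Type v} {K : Type w}

/-- A set of coloured sequences that is invariant under automorphisms, depends on the colours of
regular sequences only, and does not distinguish colours with the same image under `q`. -/
structure Saturated (q : J → K) (X : Set ((Fin (d + 3) → Base.{u} m d) × J)) : Prop where
  act : ∀ π ρ u j, (Base.act π ρ ∘ u, j) ∈ X ↔ (u, j) ∈ X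
  colour : ∀ u, (∀ σ, ¬ Regular σ u) → ∀ i j, (u, i) ∈ X → (u, j) ∈ X
  blur : ∀ u i j, q i = q j → (u, i) ∈ X → (u, j) ∈ X

theorem Saturated.mem_of_sameOrbit {q : J → K} {X : Set ((Fin (d + 3) → Base.{u} m d) × J)}
    (h : Saturated q X) {u u' : Fin (d + 3) → Base.{u} m d} (hu : SameOrbit u u') {i j : J}
    (hij : q i = q j) : (u, i) ∈ X ↔ (u', j) ∈ X := by
  obtain ⟨π, ρ, rfl⟩ := hu
  rw [h.act]
  exact ⟨h.blur _ _ _ hij, h.blur _ _ _ hij.symm⟩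

theorem saturated_funMap (q : J → K) (n : ℕ) (f : (polLang (d + 3)).Functions n)
    (x : Fin n → Set ((Fin (d + 3) → Base.{u} m d) × J)) (hx : ∀ i, Saturated q (x i)) :
    Saturated q (Structure.funMap f x) := by
  cases f with
  | add =>
    refine ⟨fun π ρ u j => or_congr ((hx 0).act π ρ u j) ((hx 1).act π ρ u j),
      fun u hu i j => Or.imp ((hx 0).colour u hu i j) ((hx 1).colour u hu i j),
      fun u i j hij => Or.imp ((hx 0).blur u i j hij) ((hx 1).blur u i j hij)⟩
  | neg =>
    exact ⟨fun π ρ u j => not_congr ((hx 0).act π ρ u j),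
      fun u hu i j => mt ((hx 0).colour u hu j i),
      fun u i j hij => mt ((hx 0).blur u j i hij.symm)⟩
  | c i =>
    -- A cylindrification does not look at the colour of its argument, so only invariance under
    -- automorphisms needs work.
    refine ⟨fun π ρ u j => ⟨?_, ?_⟩, fun u _ _ _ h => h, fun u _ _ _ h => h⟩
    · rintro ⟨⟨u', j'⟩, h, hu⟩
      refine ⟨(Base.act π⁻¹ (fun l => (ρ l)⁻¹) ∘ u', j'), ?_, fun l hl => ?_⟩
      · exact ((hx 0).act _ _ _ _).2 h
      · have := hu l hl
        simp only [Function.comp] at this ⊢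
        rw [← this, Base.act_inv_act]
    · rintro ⟨⟨u', j'⟩, h, hu⟩
      refine ⟨(Base.act π ρ ∘ u', j'), ((hx 0).act _ _ _ _).2 h, fun l hl => ?_⟩
      exact congrArg (Base.act π ρ) (hu l hl)
  | d i j =>
    exact ⟨fun π ρ u _ => (Base.act_injective π ρ).eq_iff, fun u _ _ _ h => h,
      fun u _ _ _ h => h⟩
  | p i j =>
    refine ⟨fun π ρ u k => (hx 0).act π ρ (u ∘ Equiv.swap i j) k,
      fun u hu k l => (hx 0).colour _ (fun σ => ?_) k l, fun u k l hkl => (hx 0).blur _ k l hkl⟩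
    rintro ⟨a, b, x, hab, h⟩
    refine hu (σ * Equiv.swap i j) ⟨a, b, x, hab, ?_⟩
    rw [Equiv.Perm.coe_mul, ← Function.comp_assoc, ← h, Function.comp_assoc]
    funext l
    simp

/-! ### Representing saturated sets by genuine sets of sequences. -/

section Representation

variable {q : J → K} {N : Type u} (π : N → Base.{u} m d) (χ : (Fin (d + 3) → N) → J)

/-- The set of sequences of `N` whose image, coloured by `χ`, lies in `X`. -/
def represent (X : Set ((Fin (d + 3) → Base.{u} m d) × J)) : Set (Fin (d + 3) → N) :=
  {v | (π ∘ v, χ v) ∈ X}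

variable {π χ}

/-- On non-regular sequences the colour is immaterial; on regular ones every colour, up to `q`, is
attained somewhere in the same orbit, so no part of a saturated set is lost. -/
theorem represent_injective (hπ : Function.Surjective π)
    (hχ : ∀ σ v, Regular σ (π ∘ v) → ∀ c, ∃ v', SameOrbit (π ∘ v') (π ∘ v) ∧ q (χ v') = q c)
    (X Y : Set ((Fin (d + 3) → Base.{u} m d) × J)) (hX : Saturated q X) (hY : Saturated q Y)
    (h : represent π χ X = represent π χ Y) : X = Y := by
  ext ⟨u, j⟩
  obtain ⟨v, rfl⟩ : ∃ v, π ∘ v = u :=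
    ⟨fun i => Function.surjInv hπ (u i), funext fun i => Function.surjInv_eq hπ _⟩
  by_cases hr : ∃ σ, Regular σ (π ∘ v)
  · obtain ⟨σ, hσ⟩ := hr
    obtain ⟨v', ho, hq⟩ := hχ σ v hσ j
    rw [← hX.mem_of_sameOrbit ho hq, ← hY.mem_of_sameOrbit ho hq]
    exact Set.ext_iff.1 h v'
  · push Not at hr
    have := Set.ext_iff.1 h v
    exact ⟨fun hj => hY.colour _ hr _ _ (this.1 (hX.colour _ hr _ _ hj)),
      fun hj => hX.colour _ hr _ _ (this.2 (hY.colour _ hr _ _ hj))⟩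

theorem represent_add : Preserves (Saturated q) (represent π χ) (PolOp.add (α := d + 3)) :=
  fun _ _ => rfl

theorem represent_neg : Preserves (Saturated q) (represent π χ) (PolOp.neg (α := d + 3)) :=
  fun _ _ => rfl

theorem represent_d (hπ : Function.Injective π) (i j : Fin (d + 3)) :
    Preserves (Saturated q) (represent π χ) (PolOp.d i j) := by
  intro x _
  ext v
  exact hπ.eq_iff

theorem represent_p (hχ : ∀ v (σ : Equiv.Perm (Fin (d + 3))), χ (v ∘ σ) = χ v)
    (i j : Fin (d + 3)) : Preserves (Saturated q) (represent π χ) (PolOp.p i j) := by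
  intro x _
  ext v
  refine Iff.trans ?_ mem_transposition.symm
  change (_, χ v) ∈ x 0 ↔ (_, χ (v ∘ _)) ∈ x 0
  rw [hχ]
  rfl

/-- Every colour is attained, up to `q`, by changing a regular sequence at any coordinate. -/
def Rainbow (q : J → K) (π : N → Base.{u} m d) (χ : (Fin (d + 3) → N) → J) : Prop :=
  ∀ σ v, Regular σ (π ∘ v) → ∀ i c,
    ∃ v', (∀ j, j ≠ i → v' j = v j) ∧ SameOrbit (π ∘ v') (π ∘ v) ∧ q (χ v') = q c

theorem represent_c (hπ : Function.Surjective π) (hχ : Rainbow q π χ) (i : Fin (d + 3)) :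
    Preserves (Saturated q) (represent π χ) (PolOp.c i) := by
  intro x hx
  ext v
  constructor
  · rintro ⟨⟨u', j'⟩, hu, h⟩
    obtain ⟨w, hw⟩ := hπ (u' i)
    have hv' : π ∘ Function.update v i w = u' := by
      funext l
      by_cases hl : l = i
      · subst hl; simpa using hw
      · simpa [hl] using h l hl
    generalize hg : Function.update v i w = v' at hv'
    have hvv : ∀ l, l ≠ i → v l = v' l := fun l hl => by simp [← hg, hl]
    subst hv'
    by_cases hr : ∃ σ, Regular σ (π ∘ v')
    · obtain ⟨σ, hσ⟩ := hr
      -- The lift `v'` has the right image but possibly the wrong colour; a further change of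
      -- coordinate `i` corrects the colour without leaving the orbit.
      obtain ⟨v'', h1, h2, h3⟩ := hχ σ v' hσ i j'
      exact ⟨v'', ((hx 0).mem_of_sameOrbit h2 h3).2 hu,
        fun l hl => (hvv l hl).trans (h1 l hl).symm⟩
    · push Not at hr
      exact ⟨v', (hx 0).colour _ hr _ _ hu, hvv⟩
  · rintro ⟨v', hv', h⟩
    exact ⟨(π ∘ v', χ v'), hv', fun l hl => congrArg π (h l hl)⟩

theorem Rainbow.attained (hχ : Rainbow q π χ) (σ : Equiv.Perm (Fin (d + 3))) (v : Fin (d + 3) → N)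
    (h : Regular σ (π ∘ v)) (c : J) : ∃ v', SameOrbit (π ∘ v') (π ∘ v) ∧ q (χ v') = q c :=
  (hχ σ v h 0 c).imp fun _ => And.right

end Representation

/-- A colouring is a rainbow if the colour of a regular sequence can be adjusted through either of
its points and through each of its labels. -/
theorem rainbow_id {q : J → K} {χ : (Fin (d + 3) → Base.{u} m d) → J}
    (h0 : ∀ (σ : Equiv.Perm (Fin (d + 3))) (a b : ZMod m) x c, a ≠ b →
      ∃ a', a' ≠ b ∧ q (χ (canon a' b x ∘ σ)) = q c)
    (h1 : ∀ (σ : Equiv.Perm (Fin (d + 3))) (a b : ZMod m) x c, a ≠ b →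
      ∃ b', a ≠ b' ∧ q (χ (canon a b' x ∘ σ)) = q c)
    (h2 : ∀ (σ : Equiv.Perm (Fin (d + 3))) (a b : ZMod m) x c l, a ≠ b →
      ∃ y, q (χ (canon a b (Function.update x l y) ∘ σ)) = q c) :
    Rainbow q id χ := by
  rintro σ v ⟨a, b, x, hab, hv⟩ i c
  obtain rfl : v = canon a b x ∘ σ := hv
  have key : ∀ u : Fin (d + 3) → Base.{u} m d, Regular σ (u ∘ σ) →
      (∀ l, l ≠ σ i → u l = canon a b x l) → q (χ (u ∘ σ)) = q c →
      ∃ v', (∀ j, j ≠ i → v' j = (canon a b x ∘ σ) j) ∧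
        SameOrbit (id ∘ v') (id ∘ canon a b x ∘ σ) ∧ q (χ v') = q c :=
    fun u hu h hc => ⟨u ∘ σ, fun j hj => h _ (σ.injective.ne hj),
      hu.sameOrbit ⟨a, b, x, hab, rfl⟩, hc⟩
  generalize σ i = k at key
  induction k using Fin.cases with
  | zero =>
    obtain ⟨a', ha, hc⟩ := h0 σ a b x c hab
    refine key _ ⟨a', b, x, ha, rfl⟩ (fun l hl => ?_) hc
    induction l using Fin.cases with
    | zero => exact absurd rfl hl
    | succ l => rfl
  | succ k =>
    induction k using Fin.cases with
    | zero =>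
      obtain ⟨b', hb, hc⟩ := h1 σ a b x c hab
      refine key _ ⟨a, b', x, hb, rfl⟩ (fun l hl => ?_) hc
      induction l using Fin.cases with
      | zero => rfl
      | succ l =>
        induction l using Fin.cases with
        | zero => exact absurd rfl hl
        | succ l => rfl
    | succ k =>
      obtain ⟨y, hc⟩ := h2 σ a b x c k hab
      refine key _ ⟨a, b, _, hab, rfl⟩ (fun l hl => ?_) hc
      induction l using Fin.cases with
      | zero => rfl
      | succ l =>
        induction l using Fin.cases with
        | zero => rfl
        | succ l =>
          have : l ≠ k := fun h => hl (by rw [h])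
          simp [this]

end SetAlgebra

/-! ### The four colourings, one for each harmless kind of equation. -/

namespace SetAlgebra

open EqLogic FirstOrder.Language

variable {m d : ℕ}

theorem sum_canon_comp {G : Type*} [AddCommMonoid G] (f : Base.{u} m d → G)
    (σ : Equiv.Perm (Fin (d + 3))) (a b : ZMod m) (x : Fin (d + 1) → ℤ) :
    ∑ i, f ((canon a b x ∘ σ) i) = f (.pt a) + (f (.pt b) + ∑ l, f (.lab l (x l))) := by
  have := Equiv.sum_comp σ fun i => f (canon a b x i)
  simp only [Function.comp]
  rw [this, Fin.sum_univ_succ, Fin.sum_univ_succ]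
  rfl

theorem exists_update_sum {G : Type*} [AddCommGroup G] (f : Fin (d + 1) → ℤ → G)
    (hf : ∀ l, Function.Surjective (f l)) (x : Fin (d + 1) → ℤ) (l : Fin (d + 1)) (c : G) :
    ∃ y, ∑ i, f i (Function.update x l y i) = c := by
  obtain ⟨y, hy⟩ := hf l (c - ∑ i ∈ Finset.univ.erase l, f i (x i))
  refine ⟨y, ?_⟩
  rw [← Finset.add_sum_erase _ _ (Finset.mem_univ l), Function.update_self, hy,
    sub_add_eq_add_sub, sub_eq_iff_eq_add]
  refine congrArg (c + ·) (Finset.sum_congr rfl fun i hi => ?_)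
  rw [Function.update_of_ne (Finset.ne_of_mem_erase hi)]

/-- The value of an element of the base set in `ZMod m`. -/
def Base.value : Base.{u} m d → ZMod m
  | .pt a => a
  | .perm _ => 0
  | .lab _ x => x

/-- The value of a label in `ZMod k`. -/
def Base.label (k : ℕ) : Base.{u} m d → ZMod k
  | .pt _ => 0
  | .perm _ => 0
  | .lab _ x => x

variable {k : ℕ} {J : Type v} {K : Type w} {e : Equation (polLang (d + 3))}

/-- Attaining each value twice leaves room to avoid one prohibited argument, the one that would make
the two points of a regular sequence coincide. -/
theorem exists_twofold_surjection {β : Type*} [Fintype β] [Fintype K] [Nonempty K]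
    (h : 2 * Fintype.card K ≤ Fintype.card β) :
    ∃ g : β → K, ∀ c b, ∃ b', b' ≠ b ∧ g b' = c := by
  have : Fintype.card (K × Bool) ≤ Fintype.card β := by simpa [mul_comm] using h
  obtain ⟨ι⟩ := Function.Embedding.nonempty_of_card_le this
  refine ⟨fun b => (Function.invFun ι b).1, fun c b => ?_⟩
  have hι : ∀ p, Function.invFun ι (ι p) = p := Function.leftInverse_invFun ι.injective
  by_cases hb : ι (c, true) = b
  · exact ⟨ι (c, false), fun h => by simpa using ι.injective (h.trans hb.symm), by simp [hι]⟩
  · exact ⟨ι (c, true), hb, by simp [hι]⟩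

/-- The sum of all values in `ZMod m` is symmetric, and any single coordinate can move it. The only
restriction is that the points stay distinct, and the twofold surjection onto the few blurred
colours overcomes it. -/
theorem realize_eq_of_blur [NeZero m] [Fintype K] [Nonempty J] (hK : 2 * Fintype.card K ≤ m)
    (q : J → K) (he : e ∈ pseTheory.{u} (d + 3))
    (x : ℕ → Set ((Fin (d + 3) → Base.{u} m d) × J)) (hx : ∀ v ∈ e.vars, Saturated q (x v)) :
    e.lhs.realize x = e.rhs.realize x := by
  have : Nonempty K := ⟨q (Classical.arbitrary J)⟩
  obtain ⟨g, hg⟩ := exists_twofold_surjection (K := K) (β := ZMod m) (by rwa [ZMod.card])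
  -- Outside the range of `q` this takes a default value; harmless, as only the values `q c` have to
  -- be reached.
  let s : K → J := Function.invFun q
  have hs : ∀ c, q (s (q c)) = q c := fun c => Function.invFun_eq ⟨c, rfl⟩
  let χ : (Fin (d + 3) → Base.{u} m d) → J := fun u => s (g (∑ i, (u i).value))
  have hval : ∀ (σ : Equiv.Perm (Fin (d + 3))) (a b : ZMod m) y,
      χ (canon a b y ∘ σ) = s (g (a + (b + ∑ l, (y l : ZMod m)))) :=
    fun σ a b y => congrArg (s ∘ g) (sum_canon_comp Base.value σ a b y)
  have hχ : Rainbow q id χ := by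
    refine rainbow_id (fun σ a b y c _ => ?_) (fun σ a b y c _ => ?_) fun σ a b y c l _ => ?_
    -- The excluded sum is the one that would force the new point to equal `b`.
    · obtain ⟨t, ht, htc⟩ := hg (q c) (b + (b + ∑ l, (y l : ZMod m)))
      refine ⟨t - (b + ∑ l, (y l : ZMod m)), fun h => ht (sub_eq_iff_eq_add.1 h), ?_⟩
      rw [hval, sub_add_cancel, htc, hs]
    · obtain ⟨t, ht, htc⟩ := hg (q c) (a + (a + ∑ l, (y l : ZMod m)))
      refine ⟨t - (a + ∑ l, (y l : ZMod m)), fun h => ht (sub_eq_iff_eq_add.1 h.symm), ?_⟩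
      rw [hval, add_left_comm, sub_add_cancel, htc, hs]
    · obtain ⟨t, -, htc⟩ := hg (q c) 0
      obtain ⟨z, hz⟩ := exists_update_sum (fun _ z => (z : ZMod m))
        (fun _ => ZMod.intCast_surjective) y l (t - a - b)
      refine ⟨z, ?_⟩
      rw [hval, hz, show a + (b + (t - a - b)) = t by ring, htc, hs]
  refine realize_eq_of_preserves (Saturated q) (saturated_funMap q) (represent id χ)
    (represent_injective Function.surjective_id hχ.attained) he (fun n f _ => ?_) x hx
  cases f with
  | add => exact represent_add
  | neg => exact represent_neg
  | c i => exact represent_c Function.surjective_id hχ i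
  | d i j => exact represent_d Function.injective_id i j
  | p i j =>
    refine represent_p (fun v σ => ?_) i j
    exact congrArg (s ∘ g) (Equiv.sum_comp σ fun i => (v i).value)

/-- The equations of `Pse` with few variables hold in the saturated sets. -/
theorem realize_eq_of_card_vars_le [NeZero m] [Nonempty J] {n : ℕ}
    (hm : 2 * Fintype.card (Fin n → Equiv.Perm (Fin (d + 3)) → Prop) ≤ m)
    (he : e ∈ pseTheory.{u} (d + 3)) (hn : e.vars.card ≤ n)
    (x : ℕ → Set ((Fin (d + 3) → Base.{u} m d) × J))
    (hx : ∀ v, Saturated (id : J → J) (x v)) : e.lhs.realize x = e.rhs.realize x := by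
  obtain ⟨ν, hν⟩ : ∃ ν : Fin n → ℕ, ∀ v ∈ e.vars, ∃ t, ν t = v := by
    refine ⟨fun t => if h : (t : ℕ) < e.vars.card then e.vars.equivFin.symm ⟨t, h⟩ else 0,
      fun v hv => ⟨⟨e.vars.equivFin ⟨v, hv⟩, (Fin.is_lt _).trans_le hn⟩, ?_⟩⟩
    simp
  -- Colours are identified when they have the same type: which variables contain regular sequences
  -- of that colour, for each arrangement `σ`. The number of types depends on `n` and `d` only.
  refine realize_eq_of_blur hm (fun j t σ => ∃ u, Regular σ u ∧ (u, j) ∈ x (ν t)) he x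
    fun v hv => ⟨(hx v).act, (hx v).colour, fun u i j hij hi => ?_⟩
  obtain ⟨t, rfl⟩ := hν v hv
  by_cases hr : ∃ σ, Regular σ u
  · obtain ⟨σ, hσ⟩ := hr
    have h1 := congrFun (congrFun hij t) σ
    obtain ⟨u', hu', hj⟩ := h1.mp ⟨u, hσ, hi⟩
    exact ((hx _).mem_of_sameOrbit (hu'.sameOrbit hσ) rfl).1 hj
  · push Not at hr
    exact (hx _).colour u hr i j hi

/-- The equations of `Pse` without diagonal constants hold in the saturated sets. -/
theorem realize_eq_of_not_uses_d (he : e ∈ pseTheory.{u} (d + 3))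
    (hd : ∀ i j : Fin (d + 3), ¬ e.Uses (PolOp.d i j))
    (x : ℕ → Set ((Fin (d + 3) → Base.{u} m d) × ZMod k))
    (hx : ∀ v, Saturated (id : ZMod k → ZMod k) (x v)) : e.lhs.realize x = e.rhs.realize x := by
  -- Each base element is replaced by `k` copies. Changing the copy at one coordinate adjusts the
  -- colour and leaves the image fixed; only the diagonals notice the copies.
  let χ : (Fin (d + 3) → Base.{u} m d × ZMod k) → ZMod k := fun v => ∑ i, (v i).2
  have hs : Function.Surjective (Prod.fst : Base.{u} m d × ZMod k → Base.{u} m d) :=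
    Prod.fst_surjective
  have hχ : Rainbow (id : ZMod k → ZMod k) Prod.fst χ := by
    intro σ v _ i c
    refine ⟨Function.update v i ((v i).1, c - ∑ j ∈ Finset.univ.erase i, (v j).2),
      fun j hj => Function.update_of_ne hj _ _, ?_, ?_⟩
    · convert SameOrbit.refl (Prod.fst ∘ v) using 1
      funext j
      by_cases hj : j = i
      · subst hj; simp
      · simp [hj]
    · change ∑ _, _ = c
      rw [← Finset.add_sum_erase _ _ (Finset.mem_univ i), Function.update_self,
        sub_add_eq_add_sub, sub_eq_iff_eq_add]
      refine congrArg (c + ·) (Finset.sum_congr rfl fun j hj => ?_)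
      rw [Function.update_of_ne (Finset.ne_of_mem_erase hj)]
  refine realize_eq_of_preserves (Saturated id) (saturated_funMap id) (represent Prod.fst χ)
    (represent_injective hs hχ.attained) he (fun n f hf => ?_) x fun v _ => hx v
  cases f with
  | add => exact represent_add
  | neg => exact represent_neg
  | c i => exact represent_c hs hχ i
  | d i j => exact absurd hf (hd i j)
  | p i j => exact represent_p (fun v σ => Equiv.sum_comp σ fun i => (v i).2) i j

/-- The equations of `Pse` without cylindrifications hold in the saturated sets. -/
theorem realize_eq_of_not_uses_c (he : e ∈ pseTheory.{u} (d + 3))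
    (hc : ∀ i : Fin (d + 3), ¬ e.Uses (PolOp.c i))
    (x : ℕ → Set ((Fin (d + 3) → Base.{u} m d) × ZMod k))
    (hx : ∀ v, Saturated (id : ZMod k → ZMod k) (x v)) : e.lhs.realize x = e.rhs.realize x := by
  -- The points do not influence this colour, so changing a point cannot adjust it. Without
  -- cylindrifications it suffices that each colour is attained in each orbit.
  let χ : (Fin (d + 3) → Base.{u} m d) → ZMod k := fun u => ∑ i, (u i).label k
  refine realize_eq_of_preserves (Saturated id) (saturated_funMap id) (represent id χ)
    (represent_injective Function.surjective_id ?_) he (fun n f hf => ?_) x fun v _ => hx v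
  · rintro σ v ⟨a, b, y, hab, hv⟩ c
    obtain ⟨z, hz⟩ := exists_update_sum (fun _ z => (z : ZMod k))
      (fun _ => ZMod.intCast_surjective) y 0 c
    refine ⟨canon a b (Function.update y 0 z) ∘ σ,
      Regular.sameOrbit ⟨a, b, _, hab, rfl⟩ ⟨a, b, y, hab, hv⟩, ?_⟩
    refine (sum_canon_comp (Base.label k) σ a b _).trans ?_
    simpa [Base.label] using hz
  cases f with
  | add => exact represent_add
  | neg => exact represent_neg
  | c i => exact absurd hf (hc i)
  | d i j => exact represent_d Function.injective_id i j
  | p i j => exact represent_p (fun v σ => Equiv.sum_comp σ fun i => (v i).label k) i j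

open Classical in
/-- The difference of the two points of a regular sequence, in the order of their coordinates. -/
noncomputable def orientedDifference (u : Fin (d + 3) → Base.{u} m d) : ZMod m :=
  ∑ i, ∑ j, if i < j then
    match u i, u j with
    | .pt a, .pt b => b - a
    | _, _ => 0
  else 0

/-- Among the ordered pairs of coordinates only the pair holding the two points contributes, with a
sign that depends on `σ` alone. -/
theorem orientedDifference_canon (σ : Equiv.Perm (Fin (d + 3))) :
    (∀ (a b : ZMod m) x, orientedDifference.{u} (canon a b x ∘ σ) = b - a) ∨
      ∀ (a b : ZMod m) x, orientedDifference.{u} (canon a b x ∘ σ) = a - b := by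
  have key : ∀ (a b : ZMod m) x, orientedDifference.{u} (canon a b x ∘ σ) =
      (if σ.symm 0 < σ.symm 1 then b - a else 0) + if σ.symm 1 < σ.symm 0 then a - b else 0 := by
    intro a b x
    have h1 : orientedDifference.{u} (canon a b x ∘ σ) =
        ∑ i, ∑ j, if σ.symm i < σ.symm j then
          match canon.{u} a b x i, canon.{u} a b x j with
          | .pt a, .pt b => b - a
          | _, _ => 0
        else 0 := by
      refine Eq.trans (Finset.sum_congr rfl fun i _ => ?_) (Equiv.sum_comp σ _)
      refine Eq.trans (Finset.sum_congr rfl fun j _ => ?_) (Equiv.sum_comp σ _)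
      simp only [Equiv.symm_apply_apply, Function.comp]
    rw [h1, Fin.sum_univ_succ, Fin.sum_univ_succ]
    have e1 : (Fin.succ 0 : Fin (d + 3)) = 1 := rfl
    simp [Fin.sum_univ_succ, e1]
  rcases lt_trichotomy (σ.symm 0) (σ.symm 1) with h | h | h
  · left; intro a b x; simp [key, h, h.not_gt]
  · exact absurd (σ.symm.injective h) (by simp)
  · right; intro a b x; simp [key, h, h.not_gt]

/-- The nonzero residues modulo `k + 1` have representatives `1, ..., k`, which cover all residues
modulo `k`; the representative `k` accounts for zero. -/
theorem exists_ne_zero_val_eq [NeZero k] (c : ZMod k) :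
    ∃ t : ZMod (k + 1), t ≠ 0 ∧ ((t.val : ℕ) : ZMod k) = c := by
  have hk := NeZero.ne k
  have hc := c.val_lt
  by_cases h : c = 0
  · refine ⟨(k : ℕ), fun h0 => hk ?_, ?_⟩
    · have := congrArg ZMod.val h0
      rwa [ZMod.val_natCast_of_lt (by omega), ZMod.val_zero] at this
    · rw [ZMod.val_natCast_of_lt (by omega), h, ZMod.natCast_self]
  · refine ⟨(c.val : ℕ), fun h0 => h ?_, ?_⟩
    · have := congrArg ZMod.val h0
      rw [ZMod.val_natCast_of_lt (by omega), ZMod.val_zero] at this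
      exact (ZMod.val_eq_zero c).1 this
    · rw [ZMod.val_natCast_of_lt (by omega), ZMod.natCast_zmod_val]

/-- The equations of `Pse` without transpositions hold in the saturated sets. -/
theorem realize_eq_of_not_uses_p [NeZero k] (he : e ∈ pseTheory.{u} (d + 3))
    (hp : ∀ i j : Fin (d + 3), ¬ e.Uses (PolOp.p i j))
    (x : ℕ → Set ((Fin (d + 3) → Base.{u} (k + 1) d) × ZMod k))
    (hx : ∀ v, Saturated (id : ZMod k → ZMod k) (x v)) : e.lhs.realize x = e.rhs.realize x := by
  -- With one point fixed, the other runs through `k` positions whose differences realise all `k`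
  -- colours. The price is asymmetry: exchanging the points negates the difference, so
  -- transpositions are not preserved.
  let χ : (Fin (d + 3) → Base.{u} (k + 1) d) → ZMod k := fun u =>
    (((orientedDifference u).val : ℕ) : ZMod k) + ∑ i, (u i).label k
  have hval : ∀ (σ : Equiv.Perm (Fin (d + 3))) (a b : ZMod (k + 1)) y,
      χ (canon a b y ∘ σ) = (((orientedDifference.{u} (canon a b y ∘ σ)).val : ℕ) : ZMod k) +
        ∑ l, (y l : ZMod k) := by
    intro σ a b y
    refine congrArg _ ((sum_canon_comp (Base.label k) σ a b y).trans ?_)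
    simp [Base.label]
  have hχ : Rainbow (id : ZMod k → ZMod k) id χ := by
    refine rainbow_id (fun σ a b y c _ => ?_) (fun σ a b y c _ => ?_) fun σ a b y c l _ => ?_
    · obtain ⟨t, ht, htc⟩ := exists_ne_zero_val_eq (c - ∑ l, (y l : ZMod k))
      rcases orientedDifference_canon.{u} (m := k + 1) σ with h | h
      · exact ⟨b - t, fun h0 => ht (sub_eq_self.1 h0), by
          rw [hval, h, sub_sub_cancel, htc, sub_add_cancel]⟩
      · exact ⟨b + t, fun h0 => ht (add_eq_left.1 h0), by
          rw [hval, h, add_sub_cancel_left, htc, sub_add_cancel]⟩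
    · obtain ⟨t, ht, htc⟩ := exists_ne_zero_val_eq (c - ∑ l, (y l : ZMod k))
      rcases orientedDifference_canon.{u} (m := k + 1) σ with h | h
      · exact ⟨a + t, fun h0 => ht (add_eq_left.1 h0.symm), by
          rw [hval, h, add_sub_cancel_left, htc, sub_add_cancel]⟩
      · exact ⟨a - t, fun h0 => ht (sub_eq_self.1 h0.symm), by
          rw [hval, h, sub_sub_cancel, htc, sub_add_cancel]⟩
    · rcases orientedDifference_canon.{u} (m := k + 1) σ with h | h
      · obtain ⟨z, hz⟩ := exists_update_sum (fun _ z => (z : ZMod k))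
          (fun _ => ZMod.intCast_surjective) y l (c - (((b - a).val : ℕ) : ZMod k))
        exact ⟨z, by rw [hval, h, hz, add_sub_cancel]⟩
      · obtain ⟨z, hz⟩ := exists_update_sum (fun _ z => (z : ZMod k))
          (fun _ => ZMod.intCast_surjective) y l (c - (((a - b).val : ℕ) : ZMod k))
        exact ⟨z, by rw [hval, h, hz, add_sub_cancel]⟩
  refine realize_eq_of_preserves (Saturated id) (saturated_funMap id) (represent id χ)
    (represent_injective Function.surjective_id hχ.attained) he (fun n f hf => ?_) x
    fun v _ => hx v
  cases f with
  | add => exact represent_add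
  | neg => exact represent_neg
  | c i => exact represent_c Function.surjective_id hχ i
  | d i j => exact represent_d Function.injective_id i j
  | p i j => exact absurd hf (hp i j)

end SetAlgebra

/-! ### The parity argument. -/

/-- A complete graph on an odd number of vertices, `k + 1` at most, has no proper edge colouring
in which all of `k` colours appear at every vertex. -/
theorem not_exists_one_factorization {A : Type*} [Finite A] [Nonempty A] {k : ℕ} (hk : Even k)
    (hk0 : k ≠ 0) (hA : Nat.card A ≤ k + 1) (r : Fin k → A → A → Prop)
    (hsymm : ∀ l a b, r l a b → r l b a) (hirr : ∀ l a, ¬ r l a a)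
    (hdisj : ∀ l l' a b, r l a b → r l' a b → l = l') (htot : ∀ l b, ∃ a, r l a b) : False := by
  classical
  have := Fintype.ofFinite A
  -- The neighbours of a vertex along the `k` colours are distinct and at most `k` vertices remain,
  -- so they exhaust the other vertices, and each colour is a fixed-point-free involution. Summing
  -- `1` over the vertices modulo 2 then shows their number to be even.
  rw [Nat.card_eq_fintype_card] at hA
  choose f hf using htot
  have hinj : ∀ b, Function.Injective fun l => f l b := fun b l l' h =>
    hdisj l l' _ b (hf l b) (by simpa only [h] using hf l' b)
  have himg : ∀ b, Finset.univ.image (fun l => f l b) = Finset.univ.erase b := by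
    intro b
    refine Finset.eq_of_subset_of_card_le (fun a ha => ?_) ?_
    · obtain ⟨l, -, rfl⟩ := Finset.mem_image.1 ha
      exact Finset.mem_erase.2 ⟨fun h => hirr l b (by simpa only [h] using hf l b),
        Finset.mem_univ _⟩
    · rw [Finset.card_image_of_injective _ (hinj b), Finset.card_erase_of_mem (Finset.mem_univ b),
        Finset.card_univ, Finset.card_univ, Fintype.card_fin]
      omega
  have hcard : Fintype.card A = k + 1 := by
    have b : A := Classical.arbitrary A
    have h := congrArg Finset.card (himg b)
    rw [Finset.card_image_of_injective _ (hinj b), Finset.card_erase_of_mem (Finset.mem_univ b),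
        Finset.card_univ, Finset.card_univ, Fintype.card_fin] at h
    omega
  let o : Fin k := ⟨0, Nat.pos_of_ne_zero hk0⟩
  have hinv : Function.Involutive (f o) := by
    intro b
    have hb : b ∈ Finset.univ.erase (f o b) := Finset.mem_erase.2
      ⟨fun h => hirr o b (by simpa only [← h] using hf o b), Finset.mem_univ _⟩
    rw [← himg] at hb
    obtain ⟨l, -, hl⟩ := Finset.mem_image.1 hb
    have h1 := hf l (f o b)
    rw [show f l (f o b) = b from hl] at h1
    obtain rfl := hdisj _ _ _ _ h1 (hsymm _ _ _ (hf o b))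
    exact hl
  have heven : Even (Finset.univ : Finset A).card := by
    have h : ∑ _a : A, (1 : ZMod 2) = 0 := Finset.sum_involution (fun a _ => f o a)
      (fun _ _ => by decide) (fun a _ _ h => hirr o a (by simpa only [h] using hf o a))
      (fun _ _ => Finset.mem_univ _) fun a _ => hinv a
    rw [Finset.sum_const, nsmul_eq_mul, mul_one] at h
    exact (ZMod.natCast_eq_zero_iff_even).1 h
  rw [Finset.card_univ, hcard] at heven
  exact (Nat.not_even_iff_odd.2 hk.add_one) heven

/-- A variant of `not_exists_one_factorization` for partial graphs, in which the number of vertices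
is bounded by means of relations `T i` that single out at most one vertex each. -/
theorem false_of_colouring_of_bound {U : Type*} {k : ℕ} (hk : Even k) (hk0 : k ≠ 0)
    (R : ℕ → U → U → Prop) (T : ℕ → U → U → U → Prop) {a₀ b₀ c₀ : U} (h₀ : R 0 a₀ b₀)
    (hdisj : ∀ l < k, ∀ l' < l, ∀ a b, R l a b → ¬ R l' a b)
    (hirr : ∀ l < k, ∀ a, ¬ R l a a) (hsymm : ∀ l < k, ∀ a b, R l a b → R l b a)
    (htot : ∀ l < k, ∀ l' < k, ∀ a b, R l a b → ∃ a', R l' a' b)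
    (hT : ∀ i < k + 1, ∀ a z c c', T i a z c → T i a z c')
    (hT' : ∀ i < k + 1, ∀ a z a', T i a z a' → T i a' z a → a = a')
    (hz : ∃ z, ∀ a b, R 0 a b → ∃ i < k + 1, T i a z c₀) : False := by
  have hk1 : 0 < k := Nat.pos_of_ne_zero hk0
  obtain ⟨z, hz⟩ := hz
  let A := {b // ∃ a, R 0 b a}
  choose ι hι hTι using fun b : A => hz b.1 b.2.choose b.2.choose_spec
  let g : A → Fin (k + 1) := fun b => ⟨ι b, hι b⟩
  have hg : Function.Injective g := by
    intro b b' h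
    have h' : ι b = ι b' := congrArg Fin.val h
    have h1 := hTι b
    have h2 := hTι b'
    rw [← h'] at h2
    -- Two vertices with the same index: as `T` does not depend on its last argument, `c₀` may be
    -- replaced by the other vertex, which gives the two hypotheses of `hT'`.
    exact Subtype.ext (hT' _ (hι b) _ z _ (hT _ (hι b) _ _ _ _ h1) (hT _ (hι b) _ _ _ _ h2))
  have : Finite A := Finite.of_injective g hg
  have : Nonempty A := ⟨⟨a₀, b₀, h₀⟩⟩
  refine not_exists_one_factorization (A := A) hk hk0 ?_ (fun l a b => R l a b)
    (fun l a b => hsymm l l.2 a b) (fun l a => hirr l l.2 a) (fun l l' a b h h' => ?_)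
    fun l b => ?_
  · simpa using Nat.card_le_card_of_injective g hg
  · rcases lt_trichotomy l l' with hl | hl | hl
    · exact absurd h (hdisj l' l'.2 l hl a b h')
    · exact hl
    · exact absurd h' (hdisj l l.2 l' hl a b h)
  · obtain ⟨b, a, hba⟩ := b
    -- The neighbour `a'` must be shown to be a vertex again: totality is applied once more, at
    -- `a'`, to return to colour `0`.
    obtain ⟨a', ha'⟩ := htot 0 hk1 l l.2 a b (hsymm 0 hk1 _ _ hba)
    obtain ⟨b', hb'⟩ := htot l l.2 0 hk1 b a' (hsymm l l.2 _ _ ha')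
    exact ⟨⟨a', b', hsymm 0 hk1 _ _ hb'⟩, ha'⟩

/-! ### The equation expressing the parity argument. -/

namespace SetAlgebra

open EqLogic FirstOrder.Language

section Terms

variable {α : ℕ}

/-- The sum of two terms. -/
def addTerm (s t : (polLang α).Term ℕ) : (polLang α).Term ℕ := .func PolOp.add ![s, t]

/-- The complement of a term. -/
def negTerm (t : (polLang α).Term ℕ) : (polLang α).Term ℕ := .func PolOp.neg ![t]

/-- The cylindrification of a term. -/
def cylTerm (i : Fin α) (t : (polLang α).Term ℕ) : (polLang α).Term ℕ := .func (PolOp.c i) ![t]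

/-- The diagonal constants. -/
def diagTerm (i j : Fin α) : (polLang α).Term ℕ := .func (PolOp.d i j) ![]

/-- The transposition of a term. -/
def transTerm (i j : Fin α) (t : (polLang α).Term ℕ) : (polLang α).Term ℕ :=
  .func (PolOp.p i j) ![t]

/-- The product of two terms. -/
def mulTerm (s t : (polLang α).Term ℕ) : (polLang α).Term ℕ :=
  negTerm (addTerm (negTerm s) (negTerm t))

/-- The sum of a list of terms. -/
def sumTerm (i : Fin α) (l : List ((polLang α).Term ℕ)) : (polLang α).Term ℕ :=
  l.foldr addTerm (negTerm (diagTerm i i))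

section Full

variable {U : Type u} (x : ℕ → Set (Fin α → U)) (s t : (polLang α).Term ℕ) (a : Fin α → U)

theorem mem_addTerm : a ∈ (addTerm s t).realize x ↔ a ∈ s.realize x ∨ a ∈ t.realize x := Iff.rfl

theorem mem_negTerm : a ∈ (negTerm t).realize x ↔ a ∉ t.realize x := Iff.rfl

theorem mem_mulTerm : a ∈ (mulTerm s t).realize x ↔ a ∈ s.realize x ∧ a ∈ t.realize x := by
  simp only [mulTerm, mem_negTerm, mem_addTerm]
  tauto

theorem mem_diagTerm (i j : Fin α) : a ∈ (diagTerm i j).realize x ↔ a i = a j := Iff.rfl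

theorem mem_cylTerm (i : Fin α) :
    a ∈ (cylTerm i t).realize x ↔ ∃ y, Function.update a i y ∈ t.realize x := by
  constructor
  · rintro ⟨b, hb, h⟩
    refine ⟨b i, ?_⟩
    have hab : Function.update a i (b i) = b := by
      funext j
      by_cases hj : j = i
      · subst hj; simp
      · simp [hj, h j hj]
    rw [hab]
    exact hb
  · rintro ⟨y, hy⟩
    exact ⟨_, hy, fun j hj => by simp [hj]⟩

theorem mem_transTerm (i j : Fin α) :
    a ∈ (transTerm i j t).realize x ↔ a ∘ Equiv.swap i j ∈ t.realize x := mem_transposition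

theorem mem_sumTerm (i : Fin α) (l : List ((polLang α).Term ℕ)) :
    a ∈ (sumTerm i l).realize x ↔ ∃ t ∈ l, a ∈ t.realize x := by
  induction l with
  | nil => simp [sumTerm, mem_negTerm, mem_diagTerm]
  | cons t l ih => simpa [sumTerm, mem_addTerm] using or_congr Iff.rfl ih

end Full

section Coloured

variable {M : Type u} {J : Type v} (x : ℕ → Set ((Fin α → M) × J)) (s t : (polLang α).Term ℕ)
  (a : (Fin α → M) × J)

theorem mem_addTerm_coloured :
    a ∈ (addTerm s t).realize x ↔ a ∈ s.realize x ∨ a ∈ t.realize x := Iff.rfl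

theorem mem_negTerm_coloured : a ∈ (negTerm t).realize x ↔ a ∉ t.realize x := Iff.rfl

theorem mem_mulTerm_coloured :
    a ∈ (mulTerm s t).realize x ↔ a ∈ s.realize x ∧ a ∈ t.realize x := by
  simp only [mulTerm, mem_negTerm_coloured, mem_addTerm_coloured]
  tauto

theorem mem_diagTerm_coloured (i j : Fin α) :
    a ∈ (diagTerm i j).realize x ↔ a.1 i = a.1 j := Iff.rfl

theorem mem_cylTerm_coloured (i : Fin α) :
    a ∈ (cylTerm i t).realize x ↔ ∃ b ∈ t.realize x, ∀ j, j ≠ i → a.1 j = b.1 j := Iff.rfl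

theorem mem_transTerm_coloured (i j : Fin α) :
    a ∈ (transTerm i j t).realize x ↔ (a.1 ∘ Equiv.swap i j, a.2) ∈ t.realize x := Iff.rfl

theorem mem_sumTerm_coloured (i : Fin α) (l : List ((polLang α).Term ℕ)) :
    a ∈ (sumTerm i l).realize x ↔ ∃ t ∈ l, a ∈ t.realize x := by
  induction l with
  | nil => simp [sumTerm, mem_negTerm_coloured, mem_diagTerm_coloured]
  | cons t l ih => simpa [sumTerm, mem_addTerm_coloured] using or_congr Iff.rfl ih

end Coloured

end Terms

/-- The terms whose values are empty if the variables below `k` form a symmetric edge colouring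
with `k` colours, and the next `k + 1` variables bound the number of vertices. -/
def defects (d k : ℕ) : List ((polLang (d + 3)).Term ℕ) :=
  ((List.range k).flatMap fun l =>
    ((List.range l).map fun l' => mulTerm (.var l) (.var l')) ++
    ((List.range k).map fun l' => mulTerm (.var l) (negTerm (cylTerm 0 (.var l')))) ++
    [mulTerm (.var l) (diagTerm 0 1), mulTerm (.var l) (negTerm (transTerm 0 1 (.var l)))]) ++
  ((List.range (k + 1)).flatMap fun i =>
    -- These two say that variable `k + i` depends on coordinate 2, or that it relates two distinct
    -- vertices to the same parameter at coordinate 1.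
    [mulTerm (cylTerm 2 (.var (k + i))) (negTerm (.var (k + i))),
      mulTerm (mulTerm (.var (k + i)) (transTerm 0 2 (.var (k + i)))) (negTerm (diagTerm 0 2))]) ++
  -- This defect occurs if, for every parameter at coordinate 1, some vertex is missed by all `k +
  -- 1` bounding variables.
  [negTerm (cylTerm 1 (negTerm (cylTerm 0 (mulTerm (cylTerm 1 (.var 0))
    (negTerm (sumTerm 0 ((List.range (k + 1)).map fun i => .var (k + i))))))))]

/-- The points where some defect occurs, up to the first three coordinates. -/
def defectTerm (d k : ℕ) : (polLang (d + 3)).Term ℕ :=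
  cylTerm 0 (cylTerm 1 (cylTerm 2 (sumTerm 0 (defects d k))))

/-- The equation saying that the first variable is empty unless there is a defect. -/
def colouringEquation (d k : ℕ) : Equation (polLang (d + 3)) :=
  ⟨addTerm (.var 0) (defectTerm d k), defectTerm d k⟩

section Sequences

variable {d : ℕ} {U : Type u}

/-- The sequence that starts with `a, b, c` and continues with `w`. -/
def cons₃ (a b c : U) (w : Fin d → U) : Fin (d + 3) → U :=
  Fin.cons a (Fin.cons b (Fin.cons c w))

theorem eq_cons₃ {u v : Fin (d + 3) → U} (h0 : u 0 = v 0) (h1 : u 1 = v 1) (h2 : u 2 = v 2)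
    (h : ∀ i : Fin d, u i.succ.succ.succ = v i.succ.succ.succ) : u = v := by
  funext i
  refine Fin.cases h0 (fun i => Fin.cases h1 (fun i => Fin.cases h2 h i) i) i

variable (a b c y : U) (w : Fin d → U)

theorem succ_succ_succ_ne (i : Fin d) : i.succ.succ.succ ≠ (0 : Fin (d + 3)) ∧
    i.succ.succ.succ ≠ (1 : Fin (d + 3)) ∧ i.succ.succ.succ ≠ (2 : Fin (d + 3)) := by
  refine ⟨Fin.succ_ne_zero _, fun h => ?_, fun h => ?_⟩
  · exact Fin.succ_ne_zero _ (Fin.succ_injective _ h)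
  · exact Fin.succ_ne_zero _ (Fin.succ_injective _ (Fin.succ_injective _ h))

theorem one_ne_two_fin : (1 : Fin (d + 3)) ≠ 2 :=
  (Fin.succ_injective (d + 2)).ne (Fin.succ_ne_zero (0 : Fin (d + 1))).symm

theorem zero_ne_two_fin : (0 : Fin (d + 3)) ≠ 2 :=
  (Fin.succ_ne_zero (1 : Fin (d + 2))).symm

theorem update_cons₃_zero : Function.update (cons₃ a b c w) 0 y = cons₃ y b c w :=
  Fin.update_cons_zero _ _ _

theorem update_cons₃_one : Function.update (cons₃ a b c w) 1 y = cons₃ a y c w :=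
  eq_cons₃ rfl (Function.update_self _ _ _) (Function.update_of_ne one_ne_two_fin.symm _ _)
    fun i => Function.update_of_ne (succ_succ_succ_ne i).2.1 _ _

theorem update_cons₃_two : Function.update (cons₃ a b c w) 2 y = cons₃ a b y w :=
  eq_cons₃ rfl (Function.update_of_ne one_ne_two_fin _ _) (Function.update_self _ _ _)
    fun i => Function.update_of_ne (succ_succ_succ_ne i).2.2 _ _

theorem cons₃_comp_swap_zero_one : cons₃ a b c w ∘ Equiv.swap 0 1 = cons₃ b a c w := by
  refine eq_cons₃ ?_ ?_ ?_ fun i => ?_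
  · simp only [Function.comp, Equiv.swap_apply_left]; rfl
  · simp only [Function.comp, Equiv.swap_apply_right]; rfl
  · rw [Function.comp, Equiv.swap_apply_of_ne_of_ne zero_ne_two_fin.symm one_ne_two_fin.symm]; rfl
  · have := succ_succ_succ_ne i
    rw [Function.comp, Equiv.swap_apply_of_ne_of_ne this.1 this.2.1]; rfl

theorem cons₃_comp_swap_zero_two : cons₃ a b c w ∘ Equiv.swap 0 2 = cons₃ c b a w := by
  refine eq_cons₃ ?_ ?_ ?_ fun i => ?_
  · simp only [Function.comp, Equiv.swap_apply_left]; rfl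
  · rw [Function.comp, Equiv.swap_apply_of_ne_of_ne (by simp) one_ne_two_fin]; rfl
  · simp only [Function.comp, Equiv.swap_apply_right]; rfl
  · have := succ_succ_succ_ne i
    rw [Function.comp, Equiv.swap_apply_of_ne_of_ne this.1 this.2.2]; rfl

end Sequences

/-- Outside the defects, with all coordinates from the fourth on fixed, the variables give genuine
relations on `U` to which `false_of_colouring_of_bound` applies; a sequence in the first variable
supplies a vertex. -/
theorem colouringEquation_mem_pseTheory {d k : ℕ} (hk : Even k) (hk0 : k ≠ 0) :
    colouringEquation d k ∈ pseTheory.{u} (d + 3) := by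
  refine mem_pseTheory.2 fun U x => Set.union_eq_right.2 fun u hu => ?_
  obtain ⟨a₀, b₀, c₀, w, rfl⟩ : ∃ a b c w, u = cons₃ a b c w :=
    ⟨u 0, u 1, u 2, fun i => u i.succ.succ.succ, eq_cons₃ rfl rfl rfl fun _ => rfl⟩
  by_contra hD
  have hdef : ∀ a b c, ∀ t ∈ defects d k, cons₃ a b c w ∉ t.realize x := by
    intro a b c t ht h
    refine hD ((mem_cylTerm ..).2 ⟨a, ?_⟩)
    rw [update_cons₃_zero, mem_cylTerm]
    refine ⟨b, ?_⟩
    rw [update_cons₃_one, mem_cylTerm]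
    refine ⟨c, ?_⟩
    rw [update_cons₃_two, mem_sumTerm]
    exact ⟨t, ht, h⟩
  have hvar : ∀ n a b c, cons₃ a b c w ∈ (Term.var n : (polLang (d + 3)).Term ℕ).realize x ↔
      cons₃ a b c w ∈ x n := fun _ _ _ _ => Iff.rfl
  simp only [defects, List.mem_append, List.mem_flatMap, List.mem_map, List.mem_range,
    List.mem_cons, List.not_mem_nil, or_false] at hdef
  refine false_of_colouring_of_bound hk hk0 (fun l a b => cons₃ a b c₀ w ∈ x l)
    (fun i a z c => cons₃ a z c w ∈ x (k + i)) hu ?_ ?_ ?_ ?_ ?_ ?_ (c₀ := c₀) ?_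
  · intro l hl l' hl' a b h h'
    exact hdef a b c₀ _ (Or.inl (Or.inl ⟨l, hl, Or.inl (Or.inl ⟨l', hl', rfl⟩)⟩))
      ((mem_mulTerm ..).2 ⟨h, h'⟩)
  · intro l hl a h
    exact hdef a a c₀ _ (Or.inl (Or.inl ⟨l, hl, Or.inr (Or.inl rfl)⟩))
      ((mem_mulTerm ..).2 ⟨h, rfl⟩)
  · intro l hl a b h
    have := hdef a b c₀ _ (Or.inl (Or.inl ⟨l, hl, Or.inr (Or.inr rfl)⟩))
    rw [mem_mulTerm, mem_negTerm, mem_transTerm, cons₃_comp_swap_zero_one] at this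
    by_contra h'
    exact this ⟨h, h'⟩
  · intro l hl l' hl' a b h
    have := hdef a b c₀ _ (Or.inl (Or.inl ⟨l, hl, Or.inl (Or.inr ⟨l', hl', rfl⟩)⟩))
    rw [mem_mulTerm, mem_negTerm, mem_cylTerm] at this
    simp only [update_cons₃_zero] at this
    by_contra h'
    exact this ⟨h, h'⟩
  · intro i hi a z c c' h
    have := hdef a z c' _ (Or.inl (Or.inr ⟨i, hi, Or.inl rfl⟩))
    rw [mem_mulTerm, mem_negTerm, mem_cylTerm] at this
    simp only [update_cons₃_two] at this
    by_contra h'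
    exact this ⟨⟨c, h⟩, h'⟩
  · intro i hi a z a' h h'
    have := hdef a z a' _ (Or.inl (Or.inr ⟨i, hi, Or.inr rfl⟩))
    rw [mem_mulTerm, mem_mulTerm, mem_negTerm, mem_transTerm, cons₃_comp_swap_zero_two] at this
    by_contra hne
    exact this ⟨⟨h, h'⟩, hne⟩
  · have := hdef a₀ b₀ c₀ _ (Or.inr rfl)
    simp only [mem_negTerm, mem_cylTerm, mem_mulTerm, mem_sumTerm, update_cons₃_zero,
      update_cons₃_one, List.mem_map, List.mem_range] at this
    push Not at this
    obtain ⟨z, hz⟩ := this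
    refine ⟨z, fun a b h => ?_⟩
    obtain ⟨_, ⟨i, hi, rfl⟩, h'⟩ := hz a ⟨b, h⟩
    exact ⟨i, hi, h'⟩

/-! ### Failure of the equation in the saturated sets. -/

section Counterexample

variable {d k : ℕ}

/-- The set of sequences of two distinct points and labels that have the colour `l`. -/
def colourClass (m d : ℕ) {J : Type*} (l : J) : Set ((Fin (d + 3) → Base.{u} m d) × J) :=
  {p | Regular 1 p.1 ∧ p.2 = l}

/-- The sequences that start with a point and a permutation that moves this point to `i`. -/
def pointClass {m : ℕ} (d : ℕ) (J : Type*) (i : ZMod m) :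
    Set ((Fin (d + 3) → Base.{u} m d) × J) :=
  {p | ∃ a z, p.1 0 = .pt a ∧ p.1 1 = .perm z ∧ z a = i}

theorem saturated_colourClass {m : ℕ} {J : Type*} (l : J) :
    Saturated id (colourClass.{u} m d l) where
  act π ρ _ _ := and_congr (regular_act_iff π ρ) Iff.rfl
  colour _ hu _ _ h := absurd h.1 (hu 1)
  blur _ _ _ hij h := ⟨h.1, hij.symm.trans h.2⟩

theorem saturated_pointClass {m : ℕ} {J : Type*} (i : ZMod m) :
    Saturated id (pointClass.{u} d J i) where
  act π ρ u j := by
    constructor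
    · rintro ⟨a, z, h0, h1, h⟩
      simp only [Function.comp] at h0 h1
      cases h0' : u 0 <;> rw [h0'] at h0 <;> simp only [Base.act, reduceCtorEq] at h0
      cases h1' : u 1 <;> rw [h1'] at h1 <;> simp only [Base.act, reduceCtorEq] at h1
      rename_i a' z'
      refine ⟨a', z', h0', h1', ?_⟩
      rw [← h, ← Base.pt.inj h0, ← Base.perm.inj h1]
      simp
    · rintro ⟨a, z, h0, h1, rfl⟩
      exact ⟨π a, z * π⁻¹, congrArg (Base.act π ρ) h0, congrArg (Base.act π ρ) h1, by simp⟩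
  colour _ _ _ _ h := h
  blur _ _ _ _ h := h

/-- The values that falsify `colouringEquation d k`. -/
def colouringValuation (d k n : ℕ) : Set ((Fin (d + 3) → Base.{u} (k + 1) d) × ZMod k) :=
  if n < k then colourClass (k + 1) d (n : ZMod k)
  else pointClass d (ZMod k) ((n - k : ℕ) : ZMod (k + 1))

theorem saturated_colouringValuation (n : ℕ) :
    Saturated id (colouringValuation.{u} d k n) := by
  unfold colouringValuation
  split_ifs
  · exact saturated_colourClass _
  · exact saturated_pointClass _

theorem canon_comp_swap {m : ℕ} (a b : ZMod m) (x : Fin (d + 1) → ℤ) :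
    canon.{u} a b x ∘ Equiv.swap 0 1 = canon b a x := by
  refine eq_cons₃ ?_ ?_ ?_ fun i => ?_
  · simp
  · simp
  · rw [Function.comp, Equiv.swap_apply_of_ne_of_ne zero_ne_two_fin.symm one_ne_two_fin.symm]; rfl
  · have := succ_succ_succ_ne i
    rw [Function.comp, Equiv.swap_apply_of_ne_of_ne this.1 this.2.1]; rfl

theorem not_mem_defects (hk0 : k ≠ 0) (p : (Fin (d + 3) → Base.{u} (k + 1) d) × ZMod k)
    (t : (polLang (d + 3)).Term ℕ) (ht : t ∈ defects d k) :
    p ∉ t.realize (colouringValuation d k) := by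
  have hr : ∀ l < k, ∀ p : (Fin (d + 3) → Base.{u} (k + 1) d) × ZMod k,
      p ∈ (Term.var l : (polLang (d + 3)).Term ℕ).realize (colouringValuation d k) ↔
        Regular 1 p.1 ∧ p.2 = (l : ZMod k) := by
    intro l hl p
    rw [Term.realize_var, colouringValuation, if_pos hl]
    rfl
  have hT : ∀ i, ∀ p : (Fin (d + 3) → Base.{u} (k + 1) d) × ZMod k,
      p ∈ (Term.var (k + i) : (polLang (d + 3)).Term ℕ).realize (colouringValuation d k) ↔
        ∃ a z, p.1 0 = .pt a ∧ p.1 1 = .perm z ∧ z a = (i : ZMod (k + 1)) := by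
    intro i p
    rw [Term.realize_var, colouringValuation, if_neg (by omega), Nat.add_sub_cancel_left]
    rfl
  simp only [defects, List.mem_append, List.mem_flatMap, List.mem_map, List.mem_range,
    List.mem_cons, List.not_mem_nil, or_false] at ht
  rcases ht with (⟨l, hl, (⟨l', hl', rfl⟩ | ⟨l', hl', rfl⟩) | rfl | rfl⟩ | ⟨i, hi, rfl | rfl⟩) | rfl
  · rw [mem_mulTerm_coloured, hr l hl, hr l' (hl'.trans hl)]
    rintro ⟨⟨-, h⟩, -, h'⟩
    have := congrArg ZMod.val (h.symm.trans h')
    rw [ZMod.val_natCast_of_lt hl, ZMod.val_natCast_of_lt (hl'.trans hl)] at this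
    omega
  · rw [mem_mulTerm_coloured, mem_negTerm_coloured, mem_cylTerm_coloured, hr l hl]
    rintro ⟨⟨h, -⟩, h'⟩
    -- The same sequence with another colour is a witness, because cylindrifications forget colours.
    exact h' ⟨(p.1, l'), (hr l' hl' _).2 ⟨h, rfl⟩, fun _ _ => rfl⟩
  · rw [mem_mulTerm_coloured, mem_diagTerm_coloured, hr l hl]
    rintro ⟨⟨⟨a, b, x, hab, h⟩, -⟩, h'⟩
    rw [h] at h'
    exact hab (Base.pt.inj h')
  · rw [mem_mulTerm_coloured, mem_negTerm_coloured, mem_transTerm_coloured, hr l hl, hr l hl]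
    rintro ⟨⟨⟨a, b, x, hab, h⟩, hl⟩, h'⟩
    refine h' ⟨⟨b, a, x, hab.symm, ?_⟩, hl⟩
    rw [h]
    exact canon_comp_swap a b x
  · rw [mem_mulTerm_coloured, mem_negTerm_coloured, mem_cylTerm_coloured, hT]
    rintro ⟨⟨q, hq, h⟩, h'⟩
    rw [hT, ← h 0 zero_ne_two_fin, ← h 1 one_ne_two_fin] at hq
    exact h' hq
  · rw [mem_mulTerm_coloured, mem_mulTerm_coloured, mem_negTerm_coloured, mem_transTerm_coloured,
      mem_diagTerm_coloured, hT, hT]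
    rintro ⟨⟨⟨a, z, h0, h1, h⟩, a', z', h0', h1', h'⟩, hne⟩
    simp only [Function.comp, Equiv.swap_apply_left] at h0'
    simp only [Function.comp] at h1'
    rw [Equiv.swap_apply_of_ne_of_ne (by simp) one_ne_two_fin, h1] at h1'
    obtain rfl := Base.perm.inj h1'
    obtain rfl := z.injective (h.trans h'.symm)
    exact hne (h0.trans h0'.symm)
  · simp only [mem_negTerm_coloured, not_not]
    -- The identity permutation serves as the parameter: it indexes each point `a` by `a` itself, so
    -- `k + 1` indices suffice.
    refine ⟨(Function.update p.1 1 (.perm 1), p.2), ?_, fun j hj => by simp [hj]⟩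
    rintro ⟨q, hq, h⟩
    obtain ⟨⟨⟨u, j⟩, hu, hqu⟩, hq⟩ := (mem_mulTerm_coloured ..).1 hq
    obtain ⟨⟨a, b, x, -, hu⟩, -⟩ := (hr 0 (Nat.pos_of_ne_zero hk0) _).1 hu
    refine hq ((mem_sumTerm_coloured ..).2 ⟨_, List.mem_map.2 ⟨a.val, ?_, rfl⟩, ?_⟩)
    · exact List.mem_range.2 a.val_lt
    · refine (hT _ _).2 ⟨a, 1, ?_, ?_, ?_⟩
      · rw [hqu 0 (by simp)]
        exact congrFun hu 0
      · rw [← h 1 (by simp)]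
        simp
      · simp

theorem colouringEquation_fails (hk0 : k ≠ 0) :
    (colouringEquation d k).lhs.realize (colouringValuation.{u} d k) ≠
      (colouringEquation d k).rhs.realize (colouringValuation d k) := by
  intro h
  have : Fact (1 < k + 1) := ⟨by omega⟩
  let p : (Fin (d + 3) → Base.{u} (k + 1) d) × ZMod k := (canon 0 1 0, 0)
  have hp : p ∈ (colouringEquation d k).lhs.realize (colouringValuation.{u} d k) := by
    refine Or.inl ?_
    change p ∈ colouringValuation d k 0
    rw [colouringValuation, if_pos (Nat.pos_of_ne_zero hk0)]
    exact ⟨⟨0, 1, 0, zero_ne_one, rfl⟩, by simp [p]⟩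
  rw [h] at hp
  obtain ⟨q₀, ⟨q₁, ⟨q₂, hq, -⟩, -⟩, -⟩ := hp
  obtain ⟨t, ht, hqt⟩ := (mem_sumTerm_coloured _ _ _ _).1 hq
  exact not_mem_defects hk0 _ t ht hqt

end Counterexample

/-! ### Conclusions about axiom sets. -/

/-- Every axiom set for `Pse` contains an equation with many variables in which transpositions,
diagonal constants and cylindrifications occur. -/
theorem exists_complex_axiom (d : ℕ) {E : Set (Equation (polLang (d + 3)))}
    (hE : IsEquationalAxiomSet.{u} (d + 3) E) (n : ℕ) :
    ∃ e ∈ E, n < e.vars.card ∧ (∃ i j : Fin (d + 3), e.Uses (PolOp.p i j)) ∧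
      (∃ i j : Fin (d + 3), e.Uses (PolOp.d i j)) ∧ ∃ i : Fin (d + 3), e.Uses (PolOp.c i) := by
  classical
  by_contra! hcon
  -- `N` counts the colour types with respect to `n` variables. Taking `k = 2 * N` makes the number
  -- of colours even and gives at least `2 * N` points, as the blurred colouring requires.
  let N := Fintype.card (Fin n → Equiv.Perm (Fin (d + 3)) → Prop)
  have hN : 0 < N := Fintype.card_pos
  have hk0 : 2 * N ≠ 0 := by omega
  have : NeZero (2 * N) := ⟨hk0⟩
  refine colouringEquation_fails.{u} (d := d) hk0 (Derives.sound (Saturated id)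
    (saturated_funMap id) (fun e he x hx => ?_)
    (hE.2 _ (colouringEquation_mem_pseTheory (even_two_mul N) hk0)) _ saturated_colouringValuation)
  have heT := hE.1 he
  by_cases hn : n < e.vars.card
  · by_cases hp : ∃ i j : Fin (d + 3), e.Uses (PolOp.p i j)
    · by_cases hd : ∃ i j : Fin (d + 3), e.Uses (PolOp.d i j)
      · exact realize_eq_of_not_uses_c heT (hcon e he hn hp hd) x hx
      · push Not at hd
        exact realize_eq_of_not_uses_d heT hd x hx
    · push Not at hp
      exact realize_eq_of_not_uses_p heT hp x hx
  · exact realize_eq_of_card_vars_le (n := n) (Nat.le_succ _) heT (not_lt.1 hn) x hx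

theorem not_termUses_p_onTerm {α : ℕ} (i j : Fin α) (t : (cylLang α).Term ℕ) :
    ¬ TermUses (L := polLang α) (PolOp.p i j) ((cylToPol α).onTerm t) := by
  induction t with
  | var => exact id
  | func f ts ih =>
    rintro (h | ⟨l, h⟩)
    · have h' : (⟨_, (cylToPol α).onFunction f⟩ : Σ n, PolOp α n) = ⟨1, .p i j⟩ := h
      cases f <;> cases h'
    · exact ih l h

/-- Finitely many equations have boundedly many variables, and equations of `Cs` contain no
transposition, so no member of the joint axiom set could be one of the required equations beyond
that bound. -/
theorem not_finitelyAxiomatizableOverCs (d : ℕ) :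
    ¬ FinitelyAxiomatizableOverCs.{u} (d + 3) := by
  rintro ⟨F, hF, h⟩
  have hE : IsEquationalAxiomSet.{u} (d + 3)
      (F ∪ Equation.map (cylToPol (d + 3)) '' csTheory.{u} (d + 3)) :=
    ⟨fun e he => (h e).2 (Derives.ax e he), fun e he => (h e).1 he⟩
  obtain ⟨n, hn⟩ := (hF.image fun e => e.vars.card).bddAbove
  obtain ⟨e, he, hcard, ⟨i, j, hp⟩, -⟩ := exists_complex_axiom d hE n
  rcases he with he | ⟨e, -, rfl⟩
  · exact absurd (hn ⟨e, he, rfl⟩) (not_le.2 hcard)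
  · exact hp.elim (not_termUses_p_onTerm i j _) (not_termUses_p_onTerm i j _)

end SetAlgebra

theorem theorem2 (α : ℕ) (hα : 3 ≤ α) :
    (∀ E : Set (EqLogic.Equation (SetAlgebra.polLang α)),
      SetAlgebra.IsEquationalAxiomSet.{u} α E →
        ∃ e : ℕ → EqLogic.Equation (SetAlgebra.polLang α), ∀ n : ℕ,
          e n ∈ E ∧ n < (e n).vars.card ∧
          (∃ i j : Fin α, (e n).Uses (SetAlgebra.PolOp.p i j)) ∧
          (∃ k l : Fin α, (e n).Uses (SetAlgebra.PolOp.d k l)) ∧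
          (∃ m : Fin α, (e n).Uses (SetAlgebra.PolOp.c m))) ∧
    ¬ SetAlgebra.FinitelyAxiomatizableOverCs.{u} α := by
  obtain ⟨d, rfl⟩ := Nat.exists_eq_add_of_le' hα
  refine ⟨fun E hE => ?_, SetAlgebra.not_finitelyAxiomatizableOverCs d⟩
  choose e he using fun n => SetAlgebra.exists_complex_axiom d hE n
  exact ⟨e, he⟩
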